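/- Let $\mathbb{H}$ be a complex separable Hilbert space. Let $\varphi:[0,\infty)\to[0,\infty]$ be an Orlicz function, i.e. a convex, nondecreasing function, continuous on $[0,\infty)$ (for the usual topology of $[0,\infty]$), with $\varphi(0)=0$, $\varphi(\alpha)>0$ for all $\alpha>0$, and $\varphi(\alpha)\to\infty$ as $\alpha\to\infty$. Assume $\varphi\in\delta_2(0)$, i.e. there are constants $u_0>0$ and $k_0>2$ with $\varphi(2u)\le k_0\,\varphi(u)$ for all $0\le u\le u_0$. For a compact operator $x$ on $\mathbb{H}$ let $s_0(x)\ge s_1(x)\ge\cdots$ be its singular values, that is, the eigenvalues of $|x|=(x^*x)^{1/2}$ in decreasing order, repeated according to multiplicity (continued by zeros if there are only finitely many), and put $$\mathrm{Tr}\,\varphi(x)=\sum_{n\ge0}\varphi(s_n(x))\in[0,\infty].$$ Let $S_\varphi$ be the set of compact operators $x$ on $\mathbb{H}$ with $\mathrm{Tr}\,\varphi(\lambda x)<\infty$ for some $\lambda>0$, and for $x\in S_\varphi$ let $$\|x\|_\varphi=\inf\{\lambda>0:\ \mathrm{Tr}\,\varphi(x/\lambda)\le1\}$$ be its Luxemburg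 norm. Then: 1. for every $x\in S_\varphi$ with $x\neq0$, $\mathrm{Tr}\,\varphi\!\left(x/\|x\|_\varphi\right)=1$; 2. for every $x\in S_\varphi$, $\|x\|_\varphi=1$ if and only if $\mathrm{Tr}\,\varphi(x)=1$; 3. for every sequence $(x_n)$ in $S_\varphi$, $\mathrm{Tr}\,\varphi(x_n)\to0$ if and only if $\|x_n\|_\varphi\to0$; 4. if $k$ is a nonnegative real number such that $\varphi(2\alpha)\le k\,\varphi(\alpha)$ for all $\alpha>0$, then for all $x,y\in S_\varphi$ $$\mathrm{Tr}\,\varphi(x+y)\le\frac{k}{2}\left[\mathrm{Tr}\,\varphi(x)+\mathrm{Tr}\,\varphi(y)\right].$$ -/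

import Mathlib

open scoped NNReal ENNReal Topology

namespace OrliczOperator

/-- Orlicz functions `φ : [0,∞) → [0,∞]`: convex, nondecreasing, continuous (for the usual topology
of the extended half-line), `φ(0) = 0`, `φ(α) > 0` for `α > 0`, and `φ(α) → ∞` as `α → ∞`. -/
structure IsOrlicz (φ : ℝ≥0 → ℝ≥0∞) : Prop where
  convex : ConvexOn ℝ≥0 Set.univ φ
  monotone : Monotone φ
  continuous : Continuous φ
  map_zero : φ 0 = 0
  pos : ∀ α : ℝ≥0, 0 < α → 0 < φ α
  tendsto_top : Filter.Tendsto φ Filter.atTop (𝓝 ∞)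

/-- The condition `δ₂` near zero. -/
def DeltaTwoZero (φ : ℝ≥0 → ℝ≥0∞) : Prop :=
  ∃ u₀ : ℝ≥0, 0 < u₀ ∧ ∃ k : ℝ≥0, 2 < k ∧ ∀ u : ℝ≥0, u ≤ u₀ → φ (2 * u) ≤ (k : ℝ≥0∞) * φ u

section

variable {H : Type*} [NormedAddCommGroup H] [InnerProductSpace ℂ H] [CompleteSpace H]

/-- The span of the eigenvectors of `|x| = (x* x)^(1/2)` with eigenvalue at least `t`. -/
noncomputable def eigenspaceGE (x : H →L[ℂ] H) (t : ℝ≥0) : Submodule ℂ H :=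
  ⨆ (μ : ℝ≥0) (_ : t ≤ μ),
    Module.End.eigenspace ((CFC.abs x : H →L[ℂ] H) : H →ₗ[ℂ] H) ((μ : ℝ) : ℂ)

/-- The `n`-th singular value (`n = 0, 1, 2, …`) of a compact operator `x`: the `n`-th eigenvalue of
`|x|`, the eigenvalues being listed in decreasing order and repeated according to multiplicity.
It is the largest `t` such that `|x|` has at least `n + 1` eigenvalues `≥ t`, counted with
multiplicity, and `0` if `|x|` has at most `n` positive eigenvalues. -/
noncomputable def singularValue (x : H →L[ℂ] H) (n : ℕ) : ℝ≥0 :=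
  sSup {t : ℝ≥0 | (n : Cardinal) < Module.rank ℂ (eigenspaceGE x t)}

/-- `Tr φ(x) = ∑ₙ φ(sₙ(x)) ∈ [0,∞]`. -/
noncomputable def traceOrlicz (φ : ℝ≥0 → ℝ≥0∞) (x : H →L[ℂ] H) : ℝ≥0∞ :=
  ∑' n : ℕ, φ (singularValue x n)

variable (H) in
/-- The noncommutative Orlicz sequence space `S_φ(H)`. -/
def orliczClass (φ : ℝ≥0 → ℝ≥0∞) : Set (H →L[ℂ] H) :=
  {x | IsCompactOperator x ∧ ∃ c : ℝ, 0 < c ∧ traceOrlicz φ ((c : ℂ) • x) < ∞}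

/-- The Luxemburg norm `‖x‖_φ`. -/
noncomputable def luxemburgNorm (φ : ℝ≥0 → ℝ≥0∞) (x : H →L[ℂ] H) : ℝ :=
  sInf {c : ℝ | 0 < c ∧ traceOrlicz φ ((c : ℂ)⁻¹ • x) ≤ 1}

end

end OrliczOperator

open OrliczOperator

/-! Everything reduces to scalar families. A compact `x` admits a Hilbert basis of eigenvectors of
`|x|` with eigenvalues `μ i` accumulating only at `0`. The families `μ` and `singularValue x` have
equally many terms above each positive level, so `Tr φ(x) = ∑ φ(μ i)`
(`IsSingularBasis.traceOrlicz_eq`), and scaling `x` scales `μ`.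

For the norm, consider `c ↦ ∑ φ(c μ i)`. The largest `c` with value at most `1` is the reciprocal of
the norm. Were the value there below `1`, `δ₂` would keep the sum finite slightly beyond `c`, and
convexity would then give room to increase `c` (`DeltaTwoZero.exists_tsum_eq_one`). Convexity also
gives `Tr φ(x) ≤ ‖x‖_φ` when `‖x‖_φ ≤ 1`, and iterating `δ₂` gives the converse control for small
traces.

For sums, `∑ φ(|⟨f i, x (e i)⟩|) ≤ Tr φ(x)` for orthonormal `e`, `f`
(`IsSingularBasis.tsum_inner_le`), by Jensen with a doubly substochastic matrix. Taking for `e`, `f`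
the singular vectors of `x + y` turns the operator inequality into `φ(p + q) ≤ (k/2)(φ p + φ q)`. -/

open OrliczOperator

namespace OrliczOperator

open scoped InnerProductSpace

/-! ### Diagonalisation of `|x|` for compact `x` -/

section

universe u

variable {H : Type u} [NormedAddCommGroup H] [InnerProductSpace ℂ H] [CompleteSpace H]
variable {ι : Type*}

/-- A Hilbert basis of eigenvectors of `|x|`, the eigenvalues `μ i` accumulating only at `0`. -/
structure IsSingularBasis (x : H →L[ℂ] H) (b : HilbertBasis ι ℂ H) (μ : ι → ℝ≥0) : Prop where
  abs_apply : ∀ i, (CFC.abs x : H →L[ℂ] H) (b i) = ((μ i : ℝ) : ℂ) • b i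
  finite : ∀ t : ℝ≥0, 0 < t → {i | t ≤ μ i}.Finite

theorem abs_isSymmetric (x : H →L[ℂ] H) (u v : H) :
    ⟪(CFC.abs x : H →L[ℂ] H) u, v⟫_ℂ = ⟪u, (CFC.abs x : H →L[ℂ] H) v⟫_ℂ :=
  ((ContinuousLinearMap.nonneg_iff_isPositive _).1 (CFC.abs_nonneg x)).isSymmetric u v

theorem inner_abs_apply (x : H →L[ℂ] H) (u v : H) :
    ⟪(CFC.abs x : H →L[ℂ] H) u, (CFC.abs x : H →L[ℂ] H) v⟫_ℂ = ⟪x u, x v⟫_ℂ := by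
  rw [abs_isSymmetric, ← mul_apply_eq_comp, CFC.abs_mul_abs,
    ContinuousLinearMap.star_eq_adjoint, mul_apply_eq_comp,
    ContinuousLinearMap.adjoint_inner_right]

theorem norm_abs_apply (x : H →L[ℂ] H) (u : H) : ‖(CFC.abs x : H →L[ℂ] H) u‖ = ‖x u‖ := by
  rw [@norm_eq_sqrt_re_inner ℂ, @norm_eq_sqrt_re_inner ℂ _ _ _ _ (x u), inner_abs_apply]

/-- The vector `v = |x| u - r u` satisfies `|x| v = -r v`, so positivity of `|x|` forces `v = 0` if
`r > 0`. This says nothing for `r = 0`, hence the separate hypothesis `h0`. -/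
theorem abs_apply_of_star_mul_self_apply (x : H →L[ℂ] H) (u : H) (r : ℝ≥0)
    (h : (star x * x) u = (((r ^ 2 : ℝ≥0) : ℝ) : ℂ) • u) (h0 : r = 0 → x u = 0) :
    (CFC.abs x : H →L[ℂ] H) u = ((r : ℝ) : ℂ) • u := by
  rcases eq_or_ne r 0 with rfl | hr
  · have := norm_abs_apply x u
    rw [h0 rfl, norm_zero, norm_eq_zero] at this
    simp [this]
  rw [← CFC.abs_mul_abs, mul_apply_eq_comp] at h
  set T : H →L[ℂ] H := CFC.abs x
  have hT : T.IsPositive := (ContinuousLinearMap.nonneg_iff_isPositive _).1 (CFC.abs_nonneg x)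
  set v := T u - ((r : ℝ) : ℂ) • u with hv
  have h1 : T v = -((r : ℝ) : ℂ) • v := by
    rw [hv, map_sub, map_smul, h]
    push_cast
    module
  have h2 := hT.re_inner_nonneg_left v
  rw [h1, inner_smul_left] at h2
  have h3 : ⟪v, v⟫_ℂ = ((‖v‖ ^ 2 : ℝ) : ℂ) := by
    rw [inner_self_eq_norm_sq_to_K]; norm_cast
  rw [h3] at h2
  have h4 : (0 : ℝ) ≤ -(r * ‖v‖ ^ 2) := by
    have h5 : (starRingEnd ℂ) (-((r : ℝ) : ℂ)) * ((‖v‖ ^ 2 : ℝ) : ℂ)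
        = ((-(r * ‖v‖ ^ 2) : ℝ) : ℂ) := by
      simp
    rw [h5] at h2
    exact_mod_cast h2
  have hr' : (0 : ℝ) < r := by positivity
  have h6 : ‖v‖ = 0 := by
    by_contra hne
    have : 0 < ‖v‖ := lt_of_le_of_ne (norm_nonneg _) (Ne.symm hne)
    have : 0 < r * ‖v‖ ^ 2 := by positivity
    linarith
  exact sub_eq_zero.1 (norm_eq_zero.1 h6)

/-- Hilbert bases of the eigenspaces, kernel included, are glued: the eigenspaces are mutually
orthogonal, and by the spectral theorem nothing is orthogonal to all of them. -/
theorem exists_hilbertBasis_eigenvector {A : H →L[ℂ] H} (hA : IsCompactOperator A)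
    (hA' : (A : H →ₗ[ℂ] H).IsSymmetric) :
    ∃ (ι : Type u) (b : HilbertBasis ι ℂ H) (c : ι → ℂ), ∀ i, A (b i) = c i • b i := by
  let E : ℂ → Submodule ℂ H := fun c => Module.End.eigenspace (A : H →ₗ[ℂ] H) c
  have hE : ∀ c, CompleteSpace (E c) := fun c => by
    have : IsClosed ((E c : Submodule ℂ H) : Set H) := by
      have h : ((E c : Submodule ℂ H) : Set H) = {v | A v = c • v} := by
        ext v; simp [E]
      rw [h]
      exact isClosed_eq A.continuous (continuous_const_smul c)
    exact this.completeSpace_coe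
  choose w bw hbw using fun c => exists_hilbertBasis ℂ (E c)
  have hon : Orthonormal ℂ (fun a : Σ c, w c => (bw a.1 a.2 : H)) :=
    hA'.orthogonalFamily_eigenspaces.orthonormal_sigma_orthonormal (fun c => (bw c).orthonormal)
  have hperp : (Submodule.span ℂ (Set.range fun a : Σ c, w c => (bw a.1 a.2 : H)))ᗮ = ⊥ := by
    rw [eq_bot_iff, ← ContinuousLinearMap.orthogonalComplement_iSup_eigenspaces_eq_bot hA hA']
    -- It remains to put each eigenspace inside the double complement of the span. That subspace is
    -- closed, so density of the span of `bw c` in `E c` suffices.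
    refine (Submodule.le_orthogonal_orthogonal _).trans (Submodule.orthogonal_le ?_)
    refine iSup_le fun c v hv => ?_
    have hvc : (⟨v, hv⟩ : E c) ∈ closure (Submodule.span ℂ (Set.range (bw c)) : Set (E c)) := by
      have := (bw c).dense_span
      rw [← Submodule.topologicalClosure_coe, this]
      trivial
    rw [SetLike.mem_coe.symm]
    set K := (Submodule.span ℂ (Set.range fun a : Σ c, w c => (bw a.1 a.2 : H)))ᗮᗮ
    have hK : IsClosed {z : E c | (z : H) ∈ K} :=
      (Submodule.isClosed_orthogonal _).preimage continuous_subtype_val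
    refine closure_minimal ?_ hK hvc
    have : Submodule.span ℂ (Set.range (bw c)) ≤ K.comap (E c).subtype := by
      rw [Submodule.span_le]
      rintro _ ⟨j, rfl⟩
      exact Submodule.le_orthogonal_orthogonal _ (Submodule.subset_span ⟨⟨c, j⟩, rfl⟩)
    exact this
  refine ⟨Σ c, w c, HilbertBasis.mkOfOrthogonalEqBot hon hperp, fun a => a.1, fun a => ?_⟩
  rw [HilbertBasis.coe_mkOfOrthogonalEqBot]
  exact Module.End.mem_eigenspace_iff.1 (bw a.1 a.2).2

theorem inner_apply_basis {x : H →L[ℂ] H} {b : HilbertBasis ι ℂ H} {μ : ι → ℝ≥0}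
    (h : ∀ i, (CFC.abs x : H →L[ℂ] H) (b i) = ((μ i : ℝ) : ℂ) • b i) (i j : ι) :
    ⟪x (b i), x (b j)⟫_ℂ = (μ i : ℂ) * μ j * ⟪b i, b j⟫_ℂ := by
  rw [← inner_abs_apply, h, h, inner_smul_left, inner_smul_right]
  simp
  ring

theorem norm_apply_basis {x : H →L[ℂ] H} {b : HilbertBasis ι ℂ H} {μ : ι → ℝ≥0}
    (h : ∀ i, (CFC.abs x : H →L[ℂ] H) (b i) = ((μ i : ℝ) : ℂ) • b i) (i : ι) :
    ‖x (b i)‖ = μ i := by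
  rw [← norm_abs_apply, h, norm_smul, b.orthonormal.1 i]
  simp

/-- Infinitely many such `i` would give orthogonal vectors `x (b i)` of norm at least `t`, hence a
`t`-separated sequence in the relatively compact image of the unit ball. -/
theorem finite_of_isCompactOperator {x : H →L[ℂ] H} (hx : IsCompactOperator x)
    {b : HilbertBasis ι ℂ H} {μ : ι → ℝ≥0}
    (h : ∀ i, (CFC.abs x : H →L[ℂ] H) (b i) = ((μ i : ℝ) : ℂ) • b i) (t : ℝ≥0) (ht : 0 < t) :
    {i | t ≤ μ i}.Finite := by
  by_contra hinf
  obtain ⟨f, hf⟩ := Set.Infinite.natEmbedding _ hinf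
  have hdist : ∀ m n, m ≠ n → (t : ℝ) ≤ dist (x (b (f m))) (x (b (f n))) := by
    intro m n hmn
    have hne : (f m : ι) ≠ f n := fun h => hmn (hf (Subtype.ext h))
    have h0 : ⟪x (b (f m)), x (b (f n))⟫_ℂ = 0 := by
      rw [inner_apply_basis h, b.orthonormal.2 hne, mul_zero]
    have h1 := norm_sub_sq (𝕜 := ℂ) (x (b (f m))) (x (b (f n)))
    rw [h0, norm_apply_basis h] at h1
    have h2 : (t : ℝ) ≤ μ (f m) := (f m).2
    rw [dist_eq_norm]
    refine le_of_sq_le_sq ?_ (norm_nonneg _)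
    have : (t : ℝ) ^ 2 ≤ (μ (f m) : ℝ) ^ 2 := by gcongr
    simp only [map_zero, mul_zero, sub_zero] at h1
    rw [h1]
    have := sq_nonneg ‖x (b (f n))‖
    linarith
  obtain ⟨K, hK, hKx⟩ :=
    IsCompactOperator.image_closedBall_subset_compact (f := (x : H →ₗ[ℂ] H)) hx 1
  obtain ⟨a, -, g, hg, hga⟩ := hK.tendsto_subseq (x := fun n => x (b (f n))) fun n =>
    hKx ⟨b (f n), by simp [b.orthonormal.1], rfl⟩
  have hc := hga.cauchySeq
  rw [Metric.cauchySeq_iff] at hc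
  obtain ⟨N, hN⟩ := hc t (by exact_mod_cast ht)
  have := hN N le_rfl (N + 1) (by simp)
  exact absurd this (not_lt.2 (hdist _ _ fun h => by have := hg.injective h; simp at this))

theorem exists_isSingularBasis {x : H →L[ℂ] H} (hx : IsCompactOperator x) :
    ∃ (ι : Type u) (b : HilbertBasis ι ℂ H) (μ : ι → ℝ≥0), IsSingularBasis x b μ := by
  have hA : IsCompactOperator (star x * x : H →L[ℂ] H) := hx.clm_comp (star x)
  have hA' : ((star x * x : H →L[ℂ] H) : H →ₗ[ℂ] H).IsSymmetric :=
    (IsSelfAdjoint.star_mul_self x).isSymmetric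
  obtain ⟨ι, b, c, hc⟩ := exists_hilbertBasis_eigenvector hA hA'
  have key : ∀ i, (CFC.abs x : H →L[ℂ] H) (b i) = ((‖x (b i)‖₊ : ℝ) : ℂ) • b i := by
    intro i
    refine abs_apply_of_star_mul_self_apply x (b i) _ ?_ fun h => by simpa using h
    have h1 : ⟪b i, (star x * x) (b i)⟫_ℂ = ⟪x (b i), x (b i)⟫_ℂ := by
      rw [ContinuousLinearMap.star_eq_adjoint, mul_apply_eq_comp,
        ContinuousLinearMap.adjoint_inner_right]
    rw [hc, inner_smul_right, inner_self_eq_norm_sq_to_K, inner_self_eq_norm_sq_to_K,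
      b.orthonormal.1] at h1
    rw [hc]
    congr 1
    simpa using h1
  exact ⟨ι, b, fun i => ‖x (b i)‖₊, key, finite_of_isCompactOperator hx key⟩

theorem IsSingularBasis.smul {x : H →L[ℂ] H} {b : HilbertBasis ι ℂ H} {μ : ι → ℝ≥0}
    (h : IsSingularBasis x b μ) (r : ℝ≥0) :
    IsSingularBasis (((r : ℝ) : ℂ) • x) b (fun i => r * μ i) where
  abs_apply i := by
    rw [CFC.abs_smul, smul_apply, h.abs_apply]
    rw [← Complex.coe_smul, smul_smul]
    simp
  finite t ht := by
    rcases eq_or_ne r 0 with rfl | hr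
    · simp [ht.ne']
    · refine (h.finite (t / r) (by positivity)).subset fun i hi => ?_
      exact NNReal.div_le_of_le_mul' hi

theorem IsSingularBasis.exists_ne_zero {x : H →L[ℂ] H} {b : HilbertBasis ι ℂ H} {μ : ι → ℝ≥0}
    (h : IsSingularBasis x b μ) (hx : x ≠ 0) : ∃ i, μ i ≠ 0 := by
  by_contra! h0
  refine hx (ContinuousLinearMap.ext_on (s := Set.range b) ?_ ?_)
  · exact Submodule.dense_iff_topologicalClosure_eq_top.2 b.dense_span
  · rintro _ ⟨i, rfl⟩
    have := norm_apply_basis h.abs_apply i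
    rw [h0 i] at this
    simpa using this

end

/-! ### Sums determined by a distribution function -/

theorem exists_gt_forall_imp_le {α : Type*} {a : α → ℝ≥0} (ha : ∀ t, 0 < t → {i | t ≤ a i}.Finite)
    {t : ℝ≥0} (ht : 0 < t) : ∃ t' > t, ∀ s, t < s → s ≤ t' → {i | s ≤ a i} = {i | t < a i} := by
  have hfin : {i | t < a i}.Finite := (ha t ht).subset fun i hi => (show t < a i from hi).le
  have : ∃ t' > t, ∀ i ∈ {i | t < a i}, t' ≤ a i := by
    rcases Set.eq_empty_or_nonempty {i | t < a i} with h | h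
    · exact ⟨t + 1, lt_add_one t, by simp [h]⟩
    · obtain ⟨i, hi, hmin⟩ := Set.exists_min_image _ a hfin h
      exact ⟨a i, hi, hmin⟩
  obtain ⟨t', htt', h⟩ := this
  refine ⟨t', htt', fun s hs hs' => Set.ext fun i => ⟨fun hi => ?_, fun hi => ?_⟩⟩
  · exact lt_of_lt_of_le hs hi
  · exact hs'.trans (h i hi)

theorem preimage_singleton_eq_sdiff {α : Type*} (a : α → ℝ≥0) (t : ℝ≥0) :
    a ⁻¹' {t} = {i | t ≤ a i} \ {i | t < a i} :=
  Set.ext fun _ => ⟨fun h => ⟨(show _ = t from h).ge, fun h' => (show t < _ from h').ne' h⟩,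
    fun h => le_antisymm (not_lt.1 h.2) h.1⟩

theorem setOf_lt_subset_setOf_le {α : Type*} (a : α → ℝ≥0) (t : ℝ≥0) :
    {i | t < a i} ⊆ {i | t ≤ a i} :=
  fun i hi => (show t < a i from hi).le

theorem preimage_singleton_subset_setOf_le {α : Type*} (a : α → ℝ≥0) (t : ℝ≥0) :
    a ⁻¹' {t} ⊆ {i | t ≤ a i} :=
  (preimage_singleton_eq_sdiff a t).trans_subset Set.sdiff_subset

theorem tsum_comp_eq_tsum_encard_mul {α : Type*} (a : α → ℝ≥0) (φ : ℝ≥0 → ℝ≥0∞) :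
    ∑' i, φ (a i) = ∑' t, ((a ⁻¹' {t}).encard : ℝ≥0∞) * φ t := by
  rw [← ENNReal.tsum_fiberwise _ a]
  refine tsum_congr fun t => ?_
  rw [Set.encard, ← ENNReal.tsum_const]
  exact tsum_congr fun i => congrArg φ i.2

/-- Two families with the same distribution function have the same sums. -/
theorem tsum_comp_eq_of_ncard_eq {α β : Type*} {a : α → ℝ≥0} {b : β → ℝ≥0}
    (ha : ∀ t, 0 < t → {i | t ≤ a i}.Finite) (hb : ∀ t, 0 < t → {j | t ≤ b j}.Finite)
    (h : ∀ t, 0 < t → {i | t ≤ a i}.ncard = {j | t ≤ b j}.ncard)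
    {φ : ℝ≥0 → ℝ≥0∞} (hφ : φ 0 = 0) : ∑' i, φ (a i) = ∑' j, φ (b j) := by
  have hfib : ∀ t, 0 < t → (a ⁻¹' {t}).encard = (b ⁻¹' {t}).encard := by
    intro t ht
    obtain ⟨s₁, hs₁, h₁⟩ := exists_gt_forall_imp_le ha ht
    obtain ⟨s₂, hs₂, h₂⟩ := exists_gt_forall_imp_le hb ht
    -- At a level just above `t`, common to both families, counting `≥` amounts to counting `> t`; a
    -- fibre is then a difference of two counts.
    have hs : t < min s₁ s₂ := lt_min hs₁ hs₂
    have hlt : {i | t < a i}.ncard = {j | t < b j}.ncard := by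
      rw [← h₁ _ hs (min_le_left _ _), ← h₂ _ hs (min_le_right _ _), h _ (ht.trans hs)]
    have hfa := (ha t ht).subset (preimage_singleton_subset_setOf_le a t)
    have hfb := (hb t ht).subset (preimage_singleton_subset_setOf_le b t)
    rw [← hfa.cast_ncard_eq, ← hfb.cast_ncard_eq, preimage_singleton_eq_sdiff,
      preimage_singleton_eq_sdiff,
      Set.ncard_sdiff (setOf_lt_subset_setOf_le a t)
        ((ha t ht).subset (setOf_lt_subset_setOf_le a t)),
      Set.ncard_sdiff (setOf_lt_subset_setOf_le b t)
        ((hb t ht).subset (setOf_lt_subset_setOf_le b t)), hlt, h t ht]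
  rw [tsum_comp_eq_tsum_encard_mul a, tsum_comp_eq_tsum_encard_mul b]
  refine tsum_congr fun t => ?_
  rcases eq_or_ne t 0 with rfl | ht
  -- The fibres over `0` may differ in size; they contribute nothing because `φ 0 = 0`.
  · simp [hφ]
  · rw [hfib t (pos_iff_ne_zero.2 ht)]

/-! ### Singular values versus eigenvalues of `|x|` -/

section

universe u

variable {H : Type u} [NormedAddCommGroup H] [InnerProductSpace ℂ H] [CompleteSpace H]
variable {ι : Type*} {x : H →L[ℂ] H} {b : HilbertBasis ι ℂ H} {μ : ι → ℝ≥0}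

/-- By symmetry of `|x|`, an eigenvector for `r` has zero coefficient on every `b i` with `μ i ≠ r`,
so for `r ≥ t > 0` its expansion is a finite sum. -/
theorem IsSingularBasis.eigenspaceGE_eq (h : IsSingularBasis x b μ) {t : ℝ≥0} (ht : 0 < t) :
    eigenspaceGE x t = Submodule.span ℂ (b '' {i | t ≤ μ i}) := by
  apply le_antisymm
  · refine iSup₂_le fun r hr v hv => ?_
    rw [Module.End.mem_eigenspace_iff] at hv
    have hv' : (CFC.abs x : H →L[ℂ] H) v = ((r : ℝ) : ℂ) • v := hv
    have hcoef : ∀ i, i ∉ (h.finite t ht).toFinset → b.repr v i • b i = 0 := by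
      intro i hi
      have h1 : (μ i : ℂ) * ⟪b i, v⟫_ℂ = (r : ℂ) * ⟪b i, v⟫_ℂ := by
        have := abs_isSymmetric x (b i) v
        rw [hv', h.abs_apply, inner_smul_left, inner_smul_right] at this
        simpa using this
      have h2 : μ i ≠ r := by
        rintro rfl
        simp [hr] at hi
      rw [b.repr_apply_apply]
      rcases mul_eq_mul_right_iff.1 h1 with h3 | h3
      · exact absurd (by exact_mod_cast h3) h2
      · rw [h3, zero_smul]
    have hsum := (b.hasSum_repr v).unique (hasSum_sum_of_ne_finset_zero hcoef)
    rw [hsum]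
    refine Submodule.sum_mem _ fun i hi => Submodule.smul_mem _ _ (Submodule.subset_span ⟨i, ?_, rfl⟩)
    simpa using hi
  · rw [Submodule.span_le]
    rintro _ ⟨i, hi, rfl⟩
    refine Submodule.mem_iSup_of_mem (μ i) (Submodule.mem_iSup_of_mem hi ?_)
    exact Module.End.mem_eigenspace_iff.2 (h.abs_apply i)

theorem IsSingularBasis.lt_rank_iff (h : IsSingularBasis x b μ) {t : ℝ≥0} (ht : 0 < t) (n : ℕ) :
    (n : Cardinal) < Module.rank ℂ (eigenspaceGE x t) ↔ n < {i | t ≤ μ i}.ncard := by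
  have hli : LinearIndependent ℂ (fun i : {i | t ≤ μ i} => b i) :=
    b.orthonormal.linearIndependent.comp _ Subtype.val_injective
  have := rank_span hli
  rw [← Set.image_eq_range (fun i => b i), ← h.eigenspaceGE_eq ht,
    ← Set.cast_ncard ((h.finite t ht).image _),
    Set.ncard_image_of_injective _ b.orthonormal.linearIndependent.injective] at this
  rw [this, Nat.cast_lt]

theorem IsSingularBasis.le_singularValue_iff (h : IsSingularBasis x b μ) {t : ℝ≥0} (ht : 0 < t)
    (n : ℕ) : t ≤ singularValue x n ↔ n < {i | t ≤ μ i}.ncard := by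
  have hmono : ∀ {s r : ℝ≥0}, 0 < s → s ≤ r → {i | r ≤ μ i}.ncard ≤ {i | s ≤ μ i}.ncard :=
    fun hs hsr => Set.ncard_le_ncard (fun i hi => hsr.trans hi) (h.finite _ hs)
  constructor
  · intro hle
    by_contra! hn
    have hfin := h.finite (t / 2) (by positivity)
    -- The `μ i` leave a gap `[s, t)`. If at most `n` of them reach `t`, the levels in the supremum
    -- therefore stay at or below `s`, and the supremum cannot reach `t`.
    have : ∃ s, 0 < s ∧ s < t ∧ ∀ i, s ≤ μ i → t ≤ μ i := by
      have hfin' : {i | t / 2 ≤ μ i ∧ μ i < t}.Finite := hfin.subset fun i hi => hi.1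
      rcases Set.eq_empty_or_nonempty {i | t / 2 ≤ μ i ∧ μ i < t} with he | hne
      · refine ⟨t / 2, by positivity, NNReal.half_lt_self ht.ne', fun i hi => ?_⟩
        by_contra! hlt
        exact (he ▸ (⟨hi, hlt⟩ : i ∈ {i | t / 2 ≤ μ i ∧ μ i < t}) : i ∈ (∅ : Set ι))
      · obtain ⟨j, hj, hmax⟩ := Set.exists_max_image _ μ hfin' hne
        obtain ⟨s, hs, hst⟩ := exists_between hj.2
        refine ⟨s, lt_of_le_of_lt zero_le hs, hst, fun i hi => ?_⟩
        by_contra! hlt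
        exact absurd (hmax i ⟨hj.1.trans (hs.le.trans hi), hlt⟩) (not_le.2 (hs.trans_le hi))
    obtain ⟨s, hs0, hst, hs⟩ := this
    have hsn : {i | s ≤ μ i}.ncard ≤ n :=
      (Set.ncard_le_ncard (fun i hi => hs i hi) (h.finite t ht)).trans hn
    refine absurd hle (not_le.2 (lt_of_le_of_lt (csSup_le' ?_) hst))
    intro r hr
    by_contra! hsr
    exact absurd ((h.lt_rank_iff (hs0.trans hsr) n).1 hr)
      (not_lt.2 ((hmono hs0 hsr.le).trans hsn))
  · intro hn
    refine le_csSup ?_ ((h.lt_rank_iff ht n).2 hn)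
    -- `sSup` in `ℝ≥0` needs a bound: no `μ i` exceeds `max M 1`, so levels beyond it have rank
    -- zero.
    obtain ⟨M, hM⟩ := ((h.finite 1 one_pos).image μ).bddAbove
    refine ⟨max M 1, fun r hr => ?_⟩
    by_contra! hlt
    have hr1 : 1 < r := lt_of_le_of_lt (le_max_right _ _) hlt
    have h1 := (h.lt_rank_iff (one_pos.trans hr1) n).1 hr
    obtain ⟨i, hi⟩ := Set.nonempty_of_ncard_ne_zero (Nat.ne_of_gt (lt_of_le_of_lt n.zero_le h1))
    have h2 : μ i ≤ M := hM ⟨i, hr1.le.trans hi, rfl⟩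
    exact absurd (hi.trans (h2.trans (le_max_left _ _))) (not_le.2 hlt)

theorem IsSingularBasis.traceOrlicz_eq (h : IsSingularBasis x b μ) {φ : ℝ≥0 → ℝ≥0∞}
    (hφ : φ 0 = 0) : traceOrlicz φ x = ∑' i, φ (μ i) := by
  have hset : ∀ t, 0 < t → {n | t ≤ singularValue x n} = Set.Iio {i | t ≤ μ i}.ncard :=
    fun t ht => Set.ext fun n => h.le_singularValue_iff ht n
  refine tsum_comp_eq_of_ncard_eq (fun t ht => ?_) h.finite (fun t ht => ?_) hφ
  · rw [hset t ht]
    exact Set.finite_Iio _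
  · rw [hset t ht, ← Finset.coe_Iio, Set.ncard_coe_finset, Nat.card_Iio]

end

/-! ### Jensen with subprobability weights, and Bessel -/

theorem IsOrlicz.map_add_le {φ : ℝ≥0 → ℝ≥0∞} (hφ : IsOrlicz φ) {w w' : ℝ≥0} (hw : w + w' ≤ 1)
    (a a' : ℝ≥0) : φ (w * a + w' * a') ≤ w * φ a + w' * φ a' := by
  -- The missing mass `v` is placed at `0`, where `φ` vanishes.
  obtain ⟨v, hv⟩ := exists_add_of_le hw
  have key : ∀ {p q : ℝ≥0}, p + q = 1 → ∀ c c', φ (p * c + q * c') ≤ p * φ c + q * φ c' := by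
    intro p q hpq c c'
    have := hφ.convex.2 (Set.mem_univ c) (Set.mem_univ c') (zero_le (a := p)) (zero_le (a := q)) hpq
    simpa [ENNReal.smul_def] using this
  rcases eq_or_ne (w' + v) 0 with h0 | h0
  · have hw' : w' = 0 := by simp_all
    have hv' : v = 0 := by simp_all
    subst hw' hv'
    have := key (p := w) (q := 0) (by simpa using hv.symm) a 0
    simpa using this
  · have h2 : w + (w' + v) = 1 := by rw [hv, add_assoc]
    have h3 := key h2 a (w' / (w' + v) * a')
    have h4 : (w' + v) * (w' / (w' + v) * a') = w' * a' := by field_simp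
    have h5 := key (p := w' / (w' + v)) (q := v / (w' + v)) (by field_simp) a' 0
    rw [mul_zero, add_zero, hφ.map_zero, mul_zero, add_zero] at h5
    rw [h4] at h3
    refine h3.trans (add_le_add le_rfl ?_)
    calc ((w' + v : ℝ≥0) : ℝ≥0∞) * φ (w' / (w' + v) * a')
        ≤ ((w' + v : ℝ≥0) : ℝ≥0∞) * (((w' / (w' + v) : ℝ≥0) : ℝ≥0∞) * φ a') := by gcongr
      _ = w' * φ a' := by
        rw [← mul_assoc, ← ENNReal.coe_mul, mul_div_cancel₀ _ h0]

theorem IsOrlicz.map_mul_le {φ : ℝ≥0 → ℝ≥0∞} (hφ : IsOrlicz φ) {w : ℝ≥0} (hw : w ≤ 1)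
    (a : ℝ≥0) : φ (w * a) ≤ w * φ a := by
  simpa using hφ.map_add_le (w := w) (w' := 0) (by simpa using hw) a 0

theorem IsOrlicz.map_sum_le {φ : ℝ≥0 → ℝ≥0∞} (hφ : IsOrlicz φ) {ι : Type*} (s : Finset ι)
    (w a : ι → ℝ≥0) (hw : ∑ i ∈ s, w i ≤ 1) :
    φ (∑ i ∈ s, w i * a i) ≤ ∑ i ∈ s, (w i : ℝ≥0∞) * φ (a i) := by
  classical
  induction s using Finset.induction_on generalizing w with
  | empty => simp [hφ.map_zero]
  | insert i s hi ih =>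
    rw [Finset.sum_insert hi] at hw
    rw [Finset.sum_insert hi, Finset.sum_insert hi]
    set W := ∑ j ∈ s, w j with hW
    rcases eq_or_ne W 0 with h0 | h0
    · have hz : ∀ j ∈ s, w j = 0 := by simpa [hW, Finset.sum_eq_zero_iff] using h0
      rw [Finset.sum_eq_zero fun j hj => by rw [hz j hj, zero_mul], add_zero]
      exact (hφ.map_mul_le (by simpa [h0] using hw) _).trans le_self_add
    · have h1 : ∑ j ∈ s, w j * a j = W * ∑ j ∈ s, w j / W * a j := by
        rw [Finset.mul_sum]
        exact Finset.sum_congr rfl fun j _ => by field_simp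
      have h2 := ih (fun j => w j / W) (by rw [← Finset.sum_div, ← hW, div_self h0])
      rw [h1]
      refine (hφ.map_add_le hw _ _).trans ?_
      gcongr
      calc (W : ℝ≥0∞) * φ (∑ j ∈ s, w j / W * a j)
          ≤ W * ∑ j ∈ s, ((w j / W : ℝ≥0) : ℝ≥0∞) * φ (a j) := by gcongr
        _ = ∑ j ∈ s, (w j : ℝ≥0∞) * φ (a j) := by
          rw [Finset.mul_sum]
          refine Finset.sum_congr rfl fun j _ => ?_
          rw [← mul_assoc, ← ENNReal.coe_mul, mul_div_cancel₀ _ h0]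

/-- Bessel's inequality in `[0, ∞]`. -/
theorem tsum_nnnorm_inner_sq_le {H : Type*} [NormedAddCommGroup H] [InnerProductSpace ℂ H]
    {κ : Type*} {e : κ → H} (he : Orthonormal ℂ e) (v : H) :
    ∑' i, ((‖⟪e i, v⟫_ℂ‖₊ ^ 2 : ℝ≥0) : ℝ≥0∞) ≤ ((‖v‖₊ ^ 2 : ℝ≥0) : ℝ≥0∞) := by
  rw [ENNReal.tsum_eq_iSup_sum]
  refine iSup_le fun s => ?_
  have := he.sum_inner_products_le v (s := s)
  have h : ∑ i ∈ s, ‖⟪e i, v⟫_ℂ‖₊ ^ 2 ≤ ‖v‖₊ ^ 2 := by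
    rw [← NNReal.coe_le_coe]
    push_cast
    exact this
  exact_mod_cast h

/-! ### Matrix coefficients and the trace of a sum -/

section

universe u

variable {H : Type u} [NormedAddCommGroup H] [InnerProductSpace ℂ H] [CompleteSpace H]
variable {ι : Type*} {x : H →L[ℂ] H} {b : HilbertBasis ι ℂ H} {μ : ι → ℝ≥0}

/-- The left singular vectors: `x (b i)` normalized. -/
noncomputable def leftVector (x : H →L[ℂ] H) (b : HilbertBasis ι ℂ H) (μ : ι → ℝ≥0) (i : ι) : H :=
  ((μ i : ℝ) : ℂ)⁻¹ • x (b i)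

theorem IsSingularBasis.smul_leftVector (h : IsSingularBasis x b μ) (i : ι) :
    ((μ i : ℝ) : ℂ) • leftVector x b μ i = x (b i) := by
  rcases eq_or_ne (μ i) 0 with h0 | h0
  · have := norm_apply_basis h.abs_apply i
    rw [h0] at this
    have : x (b i) = 0 := by simpa using this
    simp [leftVector, this]
  · rw [leftVector, smul_inv_smul₀ (by simpa using h0)]

theorem IsSingularBasis.orthonormal_leftVector (h : IsSingularBasis x b μ) :
    Orthonormal ℂ (fun i : {i // μ i ≠ 0} => leftVector x b μ i) := by
  classical
  rw [orthonormal_iff_ite]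
  rintro ⟨i, hi⟩ ⟨j, hj⟩
  rw [leftVector, leftVector, inner_smul_left, inner_smul_right, inner_apply_basis h.abs_apply,
    orthonormal_iff_ite.1 b.orthonormal i j]
  by_cases hij : i = j
  · subst hij
    have : (μ i : ℂ) ≠ 0 := by simpa using hi
    simp
    field_simp
  · simp [hij]

/-- Bessel for the whole index set: where `μ i = 0` the convention `0⁻¹ = 0` makes the left vector
zero, and the others are orthonormal. -/
theorem IsSingularBasis.tsum_leftVector_le (h : IsSingularBasis x b μ) (v : H) :
    ∑' i, ((‖⟪leftVector x b μ i, v⟫_ℂ‖₊ ^ 2 : ℝ≥0) : ℝ≥0∞) ≤ ((‖v‖₊ ^ 2 : ℝ≥0) : ℝ≥0∞) := by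
  refine le_trans (le_of_eq ?_) (tsum_nnnorm_inner_sq_le h.orthonormal_leftVector v)
  symm
  refine tsum_subtype_eq_of_support_subset (s := {i | μ i ≠ 0})
    (f := fun i => ((‖⟪leftVector x b μ i, v⟫_ℂ‖₊ ^ 2 : ℝ≥0) : ℝ≥0∞)) fun i hi => ?_
  intro h0
  have h0 : μ i = 0 := h0
  simp [leftVector, h0] at hi

/-- For orthonormal families `e`, `f` the numbers `|⟨f i, x (e i)⟩|` have `φ`-sum at most
`Tr φ(x)`. -/
theorem IsSingularBasis.tsum_inner_le (h : IsSingularBasis x b μ) {φ : ℝ≥0 → ℝ≥0∞}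
    (hφ : IsOrlicz φ) {κ : Type*} {e f : κ → H} (he : Orthonormal ℂ e) (hf : Orthonormal ℂ f) :
    ∑' i, φ ‖⟪f i, x (e i)⟫_ℂ‖₊ ≤ ∑' j, φ (μ j) := by
  set g := leftVector x b μ with hg
  -- By AM-GM, `Q i j` dominates the coefficient of `μ j` in the expansion of `⟨f i, x (e i)⟩`; by
  -- Bessel its rows and columns sum to at most `1`. Rows feed Jensen, columns the final exchange of
  -- sums.
  let Q : κ → ι → ℝ≥0 := fun i j => (‖⟪b j, e i⟫_ℂ‖₊ ^ 2 + ‖⟪g j, f i⟫_ℂ‖₊ ^ 2) / 2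
  have hQ : ∀ i j, (Q i j : ℝ≥0∞) =
      2⁻¹ * (((‖⟪b j, e i⟫_ℂ‖₊ ^ 2 : ℝ≥0) : ℝ≥0∞) + ((‖⟪g j, f i⟫_ℂ‖₊ ^ 2 : ℝ≥0) : ℝ≥0∞)) := by
    intro i j
    simp only [Q]
    rw [ENNReal.coe_div two_ne_zero, ENNReal.div_eq_inv_mul]
    push_cast
    rfl
  have hrow : ∀ i, ∑' j, (Q i j : ℝ≥0∞) ≤ 1 := by
    intro i
    simp_rw [hQ]
    rw [ENNReal.tsum_mul_left, ENNReal.tsum_add]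
    have h1 := tsum_nnnorm_inner_sq_le b.orthonormal (e i)
    have h2 := h.tsum_leftVector_le (f i)
    have h3 : ‖e i‖₊ = 1 := NNReal.eq (he.1 i)
    have h4 : ‖f i‖₊ = 1 := NNReal.eq (hf.1 i)
    rw [h3] at h1
    rw [h4] at h2
    refine (mul_le_mul_right (add_le_add h1 h2) _).trans ?_
    rw [one_pow, ENNReal.coe_one, one_add_one_eq_two, ENNReal.inv_mul_cancel two_ne_zero (by simp)]
  have hgn : ∀ j, ‖g j‖₊ ≤ 1 := by
    intro j
    rcases eq_or_ne (μ j) 0 with h0 | h0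
    · simp [hg, leftVector, h0]
    · exact le_of_eq (NNReal.eq (h.orthonormal_leftVector.1 ⟨j, h0⟩))
  have hcol : ∀ j, ∑' i, (Q i j : ℝ≥0∞) ≤ 1 := by
    intro j
    simp_rw [hQ]
    rw [ENNReal.tsum_mul_left, ENNReal.tsum_add]
    have h1 := tsum_nnnorm_inner_sq_le he (b j)
    have h2 := tsum_nnnorm_inner_sq_le hf (g j)
    have h3 : ‖b j‖₊ = 1 := NNReal.eq (b.orthonormal.1 j)
    have h4 : ((‖g j‖₊ ^ 2 : ℝ≥0) : ℝ≥0∞) ≤ 1 := by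
      exact_mod_cast pow_le_one' (hgn j) 2
    rw [h3, one_pow, ENNReal.coe_one] at h1
    have h5 : ∀ i, ‖⟪b j, e i⟫_ℂ‖₊ = ‖⟪e i, b j⟫_ℂ‖₊ := fun i => NNReal.eq (norm_inner_symm _ _)
    have h6 : ∀ i, ‖⟪g j, f i⟫_ℂ‖₊ = ‖⟪f i, g j⟫_ℂ‖₊ := fun i => NNReal.eq (norm_inner_symm _ _)
    simp_rw [h5, h6]
    refine (mul_le_mul_right (add_le_add h1 (h2.trans h4)) _).trans ?_
    rw [one_add_one_eq_two, ENNReal.inv_mul_cancel two_ne_zero (by simp)]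
  have hentry : ∀ i, φ ‖⟪f i, x (e i)⟫_ℂ‖₊ ≤ ∑' j, (Q i j : ℝ≥0∞) * φ (μ j) := by
    intro i
    have hsum : HasSum (fun j => ⟪f i, x (b.repr (e i) j • b j)⟫_ℂ) ⟪f i, x (e i)⟫_ℂ :=
      (((innerSL ℂ (f i)).comp x).hasSum (b.hasSum_repr (e i)))
    have hlim : Filter.Tendsto
        (fun s : Finset ι => φ ‖∑ j ∈ s, ⟪f i, x (b.repr (e i) j • b j)⟫_ℂ‖₊) Filter.atTop
        (𝓝 (φ ‖⟪f i, x (e i)⟫_ℂ‖₊)) :=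
      ((hφ.continuous.comp continuous_nnnorm).tendsto _).comp hsum
    refine le_of_tendsto' hlim fun s => ?_
    have hbound : ‖∑ j ∈ s, ⟪f i, x (b.repr (e i) j • b j)⟫_ℂ‖₊ ≤ ∑ j ∈ s, Q i j * μ j := by
      refine (nnnorm_sum_le _ _).trans (Finset.sum_le_sum fun j _ => ?_)
      rw [map_smul, ← h.smul_leftVector, b.repr_apply_apply, inner_smul_right, inner_smul_right,
        nnnorm_mul, nnnorm_mul]
      have h1 : ‖⟪f i, g j⟫_ℂ‖₊ = ‖⟪g j, f i⟫_ℂ‖₊ := NNReal.eq (norm_inner_symm _ _)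
      have h2 : ‖((μ j : ℝ) : ℂ)‖₊ = μ j := by simp
      rw [← hg, h1, h2, ← mul_assoc, mul_right_comm]
      refine mul_le_mul_left ?_ _
      rw [← NNReal.coe_le_coe]
      push_cast [Q]
      nlinarith [sq_nonneg (‖⟪b j, e i⟫_ℂ‖ - ‖⟪g j, f i⟫_ℂ‖)]
    refine (hφ.monotone hbound).trans ((hφ.map_sum_le s _ _ ?_).trans (ENNReal.sum_le_tsum s))
    have := (ENNReal.sum_le_tsum (f := fun j => (Q i j : ℝ≥0∞)) s).trans (hrow i)
    exact_mod_cast this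
  calc ∑' i, φ ‖⟪f i, x (e i)⟫_ℂ‖₊
      ≤ ∑' i, ∑' j, (Q i j : ℝ≥0∞) * φ (μ j) := ENNReal.tsum_le_tsum hentry
    _ = ∑' j, (∑' i, (Q i j : ℝ≥0∞)) * φ (μ j) := by
        rw [ENNReal.tsum_comm]
        exact tsum_congr fun j => ENNReal.tsum_mul_right
    _ ≤ ∑' j, φ (μ j) :=
        ENNReal.tsum_le_tsum fun j => (mul_le_mul_left (hcol j) _).trans (one_mul _).le

theorem traceOrlicz_add_le {φ : ℝ≥0 → ℝ≥0∞} (hφ : IsOrlicz φ) {k : ℝ≥0}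
    (hk : ∀ α : ℝ≥0, 0 < α → φ (2 * α) ≤ (k : ℝ≥0∞) * φ α) {x y : H →L[ℂ] H}
    (hx : IsCompactOperator x) (hy : IsCompactOperator y) :
    traceOrlicz φ (x + y) ≤ (k : ℝ≥0∞) / 2 * (traceOrlicz φ x + traceOrlicz φ y) := by
  obtain ⟨ι₁, b₁, μ₁, h₁⟩ := exists_isSingularBasis hx
  obtain ⟨ι₂, b₂, μ₂, h₂⟩ := exists_isSingularBasis hy
  obtain ⟨ι, b, μ, h⟩ := exists_isSingularBasis (x := x + y) (hx.add hy)
  have hk' : ∀ α, φ (2 * α) ≤ (k : ℝ≥0∞) * φ α := by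
    intro α
    rcases eq_or_ne α 0 with rfl | h0
    · simp [hφ.map_zero]
    · exact hk α (pos_iff_ne_zero.2 h0)
  -- These are the singular vectors of `x + y`, for which `⟨f i, (x + y) (e i)⟩ = μ i`.
  let e : {i // μ i ≠ 0} → H := fun i => b i
  let f : {i // μ i ≠ 0} → H := fun i => leftVector (x + y) b μ i
  have he : Orthonormal ℂ e := b.orthonormal.comp _ Subtype.val_injective
  have hf : Orthonormal ℂ f := h.orthonormal_leftVector
  have hterm : ∀ i : {i // μ i ≠ 0}, φ (μ i) ≤
      (k : ℝ≥0∞) / 2 * (φ ‖⟪f i, x (e i)⟫_ℂ‖₊ + φ ‖⟪f i, y (e i)⟫_ℂ‖₊) := by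
    intro i
    have h3 : μ i ≤ ‖⟪f i, x (e i)⟫_ℂ‖₊ + ‖⟪f i, y (e i)⟫_ℂ‖₊ := by
      have h4 : ⟪f i, x (e i)⟫_ℂ + ⟪f i, y (e i)⟫_ℂ = ((μ i : ℝ) : ℂ) := by
        rw [← inner_add_right, ← add_apply, ← h.smul_leftVector, inner_smul_right,
          inner_self_eq_norm_sq_to_K, hf.1]
        simp
      have h5 := nnnorm_add_le ⟪f i, x (e i)⟫_ℂ ⟪f i, y (e i)⟫_ℂ
      rw [h4] at h5
      simpa using h5
    refine (hφ.monotone h3).trans ?_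
    set p := ‖⟪f i, x (e i)⟫_ℂ‖₊
    set q := ‖⟪f i, y (e i)⟫_ℂ‖₊
    -- `p + q` is the midpoint of `2p` and `2q`, whence the factor `k / 2`.
    have h6 := hφ.map_add_le (w := 2⁻¹) (w' := 2⁻¹) (by norm_num) (2 * p) (2 * q)
    rw [inv_mul_cancel_left₀ two_ne_zero, inv_mul_cancel_left₀ two_ne_zero] at h6
    refine h6.trans ?_
    rw [← mul_add, ENNReal.coe_inv two_ne_zero, ENNReal.div_eq_inv_mul, mul_assoc, mul_add (k : ℝ≥0∞)]
    exact mul_le_mul_right (add_le_add (hk' p) (hk' q)) _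
  have hsub : ∑' i, φ (μ i) = ∑' i : {i // μ i ≠ 0}, φ (μ i) := by
    symm
    refine tsum_subtype_eq_of_support_subset (s := {i | μ i ≠ 0}) (f := fun i => φ (μ i))
      fun i hi h0 => hi ?_
    have h0 : μ i = 0 := h0
    simp [h0, hφ.map_zero]
  rw [h.traceOrlicz_eq hφ.map_zero, h₁.traceOrlicz_eq hφ.map_zero, h₂.traceOrlicz_eq hφ.map_zero,
    hsub]
  refine (ENNReal.tsum_le_tsum hterm).trans ?_
  rw [ENNReal.tsum_mul_left, ENNReal.tsum_add]
  exact mul_le_mul_right (add_le_add (h₁.tsum_inner_le hφ he hf) (h₂.tsum_inner_le hφ he hf)) _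

end

/-! ### The function `c ↦ ∑ φ (c μ i)` -/

section Family

variable {φ : ℝ≥0 → ℝ≥0∞} {ι : Type*} {μ : ι → ℝ≥0}

/-- Iterating the `δ₂` condition. -/
theorem map_two_pow_mul_le {u₀ k : ℝ≥0} (h : ∀ u, u ≤ u₀ → φ (2 * u) ≤ (k : ℝ≥0∞) * φ u)
    (m : ℕ) {u : ℝ≥0} (hu : 2 ^ m * u ≤ u₀) : φ (2 ^ m * u) ≤ (k : ℝ≥0∞) ^ m * φ u := by
  induction m with
  | zero => simp
  | succ m ih =>
    have h1 : (2 : ℝ≥0) ^ m * u ≤ 2 ^ (m + 1) * u := by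
      gcongr
      · norm_num
      · omega
    have h2 : (2 : ℝ≥0) ^ m * u ≤ u₀ := h1.trans hu
    calc φ (2 ^ (m + 1) * u) = φ (2 * (2 ^ m * u)) := by rw [pow_succ']; ring_nf
      _ ≤ k * φ (2 ^ m * u) := h _ h2
      _ ≤ k * (k ^ m * φ u) := by gcongr; exact ih h2
      _ = k ^ (m + 1) * φ u := by rw [pow_succ', mul_assoc]

theorem IsOrlicz.tsum_mul_le (hφ : IsOrlicz φ) {c : ℝ≥0} (hc : c ≤ 1) (μ : ι → ℝ≥0) :
    ∑' i, φ (c * μ i) ≤ c * ∑' i, φ (μ i) := by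
  rw [← ENNReal.tsum_mul_left]
  exact ENNReal.tsum_le_tsum fun i => hφ.map_mul_le hc _

/-- Under `δ₂`, the sum `∑ φ (c μ i)` is finite as soon as each term is. -/
theorem DeltaTwoZero.tsum_lt_top (hδ : DeltaTwoZero φ) (hφ : IsOrlicz φ)
    (hμ : ∀ t : ℝ≥0, 0 < t → {i | t ≤ μ i}.Finite) {c₀ c : ℝ≥0} (hc₀ : 0 < c₀)
    (h₀ : ∑' i, φ (c₀ * μ i) < ∞) (hc : ∀ i, φ (c * μ i) < ∞) : ∑' i, φ (c * μ i) < ∞ := by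
  classical
  obtain ⟨u₀, hu₀, k, -, hk⟩ := hδ
  obtain ⟨m, hm⟩ := pow_unbounded_of_one_lt (c / c₀) one_lt_two
  have hcm : c ≤ 2 ^ m * c₀ := (div_le_iff₀ hc₀).1 hm.le
  -- Below this threshold `2 ^ m * (c₀ * μ i) ≤ u₀`, so the iterated `δ₂` bound applies; only
  -- finitely many terms are left over.
  have hfin := hμ (u₀ / (2 ^ m * c₀)) (by positivity)
  set s := hfin.toFinset
  have hbound : ∀ i, φ (c * μ i) ≤
      (if i ∈ s then φ (c * μ i) else 0) + (k : ℝ≥0∞) ^ m * φ (c₀ * μ i) := by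
    intro i
    split_ifs with hi
    · exact le_self_add
    · rw [zero_add]
      have h1 : μ i < u₀ / (2 ^ m * c₀) := by simpa [s] using hi
      have h2 : 2 ^ m * (c₀ * μ i) ≤ u₀ := by
        rw [← mul_assoc, mul_comm]
        exact ((lt_div_iff₀ (by positivity)).1 h1).le
      refine le_trans (hφ.monotone ?_) (map_two_pow_mul_le hk m h2)
      rw [← mul_assoc]
      gcongr
  refine lt_of_le_of_lt (ENNReal.tsum_le_tsum hbound) ?_
  rw [ENNReal.tsum_add, ENNReal.tsum_mul_left, ENNReal.add_lt_top]
  refine ⟨?_, ENNReal.mul_lt_top (ENNReal.pow_lt_top ENNReal.coe_lt_top) h₀⟩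
  rw [tsum_eq_sum (s := s) fun i hi => if_neg hi]
  refine ENNReal.sum_lt_top.2 fun i hi => ?_
  rw [if_pos hi]
  exact hc i

/-- The unit level of `c ↦ ∑ φ (c μ i)` is attained at its largest admissible argument. -/
theorem DeltaTwoZero.exists_tsum_eq_one (hδ : DeltaTwoZero φ) (hφ : IsOrlicz φ)
    (hμ : ∀ t : ℝ≥0, 0 < t → {i | t ≤ μ i}.Finite) (hne : ∃ i, μ i ≠ 0) {c₀ : ℝ≥0} (hc₀ : 0 < c₀)
    (h₀ : ∑' i, φ (c₀ * μ i) < ∞) :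
    ∃ c : ℝ≥0, 0 < c ∧ ∑' i, φ (c * μ i) = 1 ∧
      ∀ c' : ℝ≥0, ∑' i, φ (c' * μ i) ≤ 1 → c' ≤ c := by
  set S : Set ℝ≥0 := {c | ∑' i, φ (c * μ i) ≤ 1} with hS
  have hbdd : BddAbove S := by
    obtain ⟨i, hi⟩ := hne
    obtain ⟨M, hM⟩ := Filter.eventually_atTop.1
      (hφ.tendsto_top.eventually (lt_mem_nhds ENNReal.one_lt_top))
    refine ⟨M / μ i, fun c hc => ?_⟩
    by_contra! hlt
    have h1 : M < c * μ i := (div_lt_iff₀ (pos_iff_ne_zero.2 hi)).1 hlt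
    exact absurd ((ENNReal.le_tsum i).trans hc) (not_le.2 (hM _ h1.le))
  obtain ⟨c₁, hc₁, hc₁S⟩ : ∃ c₁, 0 < c₁ ∧ c₁ ∈ S := by
    set F := ∑' i, φ (c₀ * μ i)
    -- Convexity bounds the sum here by `F / (F + 1)`; the `+ 1` also keeps the factor at most `1`.
    refine ⟨(F.toNNReal + 1)⁻¹ * c₀, by positivity, ?_⟩
    have hle : (F.toNNReal + 1)⁻¹ ≤ 1 := inv_le_one_of_one_le₀ le_add_self
    have h1 := hφ.tsum_mul_le hle (fun i => c₀ * μ i)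
    simp only [← mul_assoc] at h1
    refine h1.trans ?_
    change _ * F ≤ 1
    rw [← ENNReal.coe_toNNReal h₀.ne, ← ENNReal.coe_mul, ENNReal.toNNReal_coe]
    rw [← ENNReal.coe_one, ENNReal.coe_le_coe, inv_mul_le_iff₀ (by positivity), mul_one]
    exact le_self_add
  set c := sSup S with hc
  have hcpos : 0 < c := hc₁.trans_le (le_csSup hbdd hc₁S)
  -- Lower semicontinuity: each finite partial sum is continuous in the scalar.
  have hle : ∑' i, φ (c * μ i) ≤ 1 := by
    rw [ENNReal.tsum_eq_iSup_sum]
    refine iSup_le fun s => ?_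
    obtain ⟨u, -, hu, huS⟩ := exists_seq_tendsto_sSup ⟨c₁, hc₁S⟩ hbdd
    have hcont : Continuous fun r : ℝ≥0 => ∑ i ∈ s, φ (r * μ i) :=
      continuous_finsetSum _ fun i _ => hφ.continuous.comp (continuous_mul_const _)
    exact le_of_tendsto' ((hcont.tendsto _).comp hu) fun n =>
      (ENNReal.sum_le_tsum s).trans (huS n)
  refine ⟨c, hcpos, le_antisymm hle ?_, fun c' hc' => le_csSup hbdd hc'⟩
  by_contra! hlt
  -- As `φ` may take the value `∞`, finiteness of the terms beyond `c` needs proof: continuity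
  -- handles the finitely many large `μ i`, and for the others `r < 2c` keeps `r * μ i` below a
  -- point `M` with `φ M < ∞`.
  obtain ⟨c₂, hc₂, hF⟩ : ∃ c₂ > c, ∑' i, φ (c₂ * μ i) < ∞ := by
    obtain ⟨M, hMpos, hM⟩ : ∃ M : ℝ≥0, 0 < M ∧ φ M < ∞ := by
      have h1 : Filter.Tendsto φ (𝓝[>] 0) (𝓝 0) := by
        have := (hφ.continuous.tendsto 0).mono_left (nhdsWithin_le_nhds (s := Set.Ioi 0))
        rwa [hφ.map_zero] at this
      obtain ⟨M, h2, h3⟩ := ((h1.eventually (gt_mem_nhds ENNReal.zero_lt_top)).and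
        self_mem_nhdsWithin).exists
      exact ⟨M, h3, h2⟩
    have hfin := hμ (M / (2 * c)) (by positivity)
    have hev : ∀ᶠ r in 𝓝[>] c, ∀ i ∈ {i | M / (2 * c) ≤ μ i}, φ (r * μ i) < ∞ := by
      rw [Filter.eventually_all_finite hfin]
      intro i _
      have hcont : Continuous fun r : ℝ≥0 => φ (r * μ i) :=
        hφ.continuous.comp (continuous_mul_const _)
      exact nhdsWithin_le_nhds ((hcont.tendsto c).eventually
        (gt_mem_nhds (lt_of_le_of_lt ((ENNReal.le_tsum i).trans hle) ENNReal.one_lt_top)))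
    have hlt2 : c < 2 * c := by
      rw [two_mul]; exact lt_add_of_pos_left _ hcpos
    obtain ⟨r, ⟨hr, hr2⟩, hrc⟩ := ((hev.and (nhdsWithin_le_nhds (gt_mem_nhds hlt2))).and
      self_mem_nhdsWithin).exists
    refine ⟨r, hrc, hδ.tsum_lt_top hφ hμ hc₀ h₀ fun i => ?_⟩
    by_cases hi : M / (2 * c) ≤ μ i
    · exact hr i hi
    · refine lt_of_le_of_lt (hφ.monotone ?_) hM
      calc r * μ i ≤ 2 * c * (M / (2 * c)) := by
            gcongr
            exact (not_le.1 hi).le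
        _ = M := mul_div_cancel₀ _ (by positivity)
  set A := ∑' i, φ (c * μ i)
  set B := ∑' i, φ (c₂ * μ i)
  -- As `B < ∞` and `A < 1`, a small `t > 0` gives an admissible scalar larger than `c`.
  have hconv : ∀ t : ℝ≥0, t ≤ 1 → ∑' i, φ (((1 - t) * c + t * c₂) * μ i) ≤ A + t * B := by
    intro t ht
    calc ∑' i, φ (((1 - t) * c + t * c₂) * μ i)
        ≤ ∑' i, (φ (c * μ i) + t * φ (c₂ * μ i)) := by
          refine ENNReal.tsum_le_tsum fun i => ?_
          rw [add_mul, mul_assoc, mul_assoc]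
          refine (hφ.map_add_le (tsub_add_cancel_of_le ht).le _ _).trans (add_le_add ?_ le_rfl)
          refine (mul_le_mul_left (?_ : _ ≤ (1 : ℝ≥0∞)) _).trans (one_mul _).le
          exact_mod_cast tsub_le_self
      _ = A + t * B := by rw [ENNReal.tsum_add, ENNReal.tsum_mul_left]
  have hlim : Filter.Tendsto (fun t : ℝ≥0 => A + (t : ℝ≥0∞) * B) (𝓝[>] 0) (𝓝 A) := by
    have h1 : Continuous fun t : ℝ≥0 => A + (t : ℝ≥0∞) * B :=
      continuous_const.add ((ENNReal.continuous_mul_const hF.ne).comp ENNReal.continuous_coe)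
    have h2 := (h1.tendsto 0).mono_left (nhdsWithin_le_nhds (s := Set.Ioi 0))
    simpa using h2
  obtain ⟨t, ⟨ht1, ht2⟩, ht0⟩ := (((hlim.eventually (gt_mem_nhds hlt)).and
    (nhdsWithin_le_nhds (gt_mem_nhds one_pos))).and self_mem_nhdsWithin).exists
  have hmem : (1 - t) * c + t * c₂ ∈ S := (hconv t (le_of_lt ht2)).trans (le_of_lt ht1)
  have hgt : c < (1 - t) * c + t * c₂ := by
    calc c = (1 - t) * c + t * c := by
          rw [← add_mul, tsub_add_cancel_of_le (le_of_lt ht2), one_mul]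
      _ < (1 - t) * c + t * c₂ := by
          have h3 : t * c < t * c₂ := mul_lt_mul_of_pos_left hc₂ ht0
          exact add_lt_add_of_le_of_lt le_rfl h3
  exact absurd (le_csSup hbdd hmem) (not_le.2 hgt)

end Family

/-! ### The Luxemburg norm -/

section

universe u

variable {H : Type u} [NormedAddCommGroup H] [InnerProductSpace ℂ H] [CompleteSpace H]
variable {φ : ℝ≥0 → ℝ≥0∞} {x : H →L[ℂ] H}

theorem IsSingularBasis.traceOrlicz_smul {ι : Type*} {b : HilbertBasis ι ℂ H} {μ : ι → ℝ≥0}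
    (h : IsSingularBasis x b μ) (hφ : φ 0 = 0) (r : ℝ≥0) :
    traceOrlicz φ (((r : ℝ) : ℂ) • x) = ∑' i, φ (r * μ i) :=
  (h.smul r).traceOrlicz_eq hφ

theorem traceOrlicz_zero (hφ : φ 0 = 0) : traceOrlicz φ (0 : H →L[ℂ] H) = 0 := by
  obtain ⟨ι, b, μ, h⟩ := exists_isSingularBasis (x := (0 : H →L[ℂ] H)) isCompactOperator_zero
  have := h.traceOrlicz_smul hφ 0
  simpa [hφ] using this

theorem luxemburgNorm_zero (hφ : φ 0 = 0) : luxemburgNorm φ (0 : H →L[ℂ] H) = 0 := by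
  have : {c : ℝ | 0 < c ∧ traceOrlicz φ ((c : ℂ)⁻¹ • (0 : H →L[ℂ] H)) ≤ 1} = Set.Ioi 0 := by
    ext c
    simp [traceOrlicz_zero hφ]
  rw [luxemburgNorm, this, csInf_Ioi]

theorem traceOrlicz_smul_le (hφ : IsOrlicz φ) (hx : IsCompactOperator x) {r : ℝ≥0} (hr : r ≤ 1) :
    traceOrlicz φ (((r : ℝ) : ℂ) • x) ≤ r * traceOrlicz φ x := by
  obtain ⟨ι, b, μ, h⟩ := exists_isSingularBasis hx
  rw [h.traceOrlicz_smul hφ.map_zero, h.traceOrlicz_eq hφ.map_zero]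
  exact hφ.tsum_mul_le hr μ

/-- The Luxemburg norm of a nonzero operator is positive, and is attained at trace `1`. -/
theorem luxemburgNorm_pos_and_traceOrlicz_eq_one (hφ : IsOrlicz φ) (hδ : DeltaTwoZero φ)
    (hx : x ∈ orliczClass H φ) (hx0 : x ≠ 0) :
    0 < luxemburgNorm φ x ∧ traceOrlicz φ ((luxemburgNorm φ x : ℂ)⁻¹ • x) = 1 := by
  obtain ⟨hxc, c₀, hc₀, h₀⟩ := hx
  lift c₀ to ℝ≥0 using hc₀.le
  obtain ⟨ι, b, μ, h⟩ := exists_isSingularBasis hxc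
  rw [h.traceOrlicz_smul hφ.map_zero] at h₀
  obtain ⟨c, hc, hc1, hmax⟩ := hδ.exists_tsum_eq_one hφ h.finite (h.exists_ne_zero hx0)
    (by exact_mod_cast hc₀) h₀
  rw [← h.traceOrlicz_smul hφ.map_zero] at hc1
  -- Inversion turns the largest admissible multiplier into the least admissible divisor.
  have hleast : IsLeast {c : ℝ | 0 < c ∧ traceOrlicz φ ((c : ℂ)⁻¹ • x) ≤ 1} ((c⁻¹ : ℝ≥0) : ℝ) := by
    refine ⟨⟨by positivity, ?_⟩, ?_⟩
    · simpa using hc1.le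
    · rintro r ⟨hr, hr1⟩
      lift r to ℝ≥0 using hr.le
      have h1 : ((r : ℝ) : ℂ)⁻¹ = (((r⁻¹ : ℝ≥0) : ℝ) : ℂ) := by simp
      rw [h1, h.traceOrlicz_smul hφ.map_zero] at hr1
      have hr' : 0 < r := by exact_mod_cast hr
      exact_mod_cast inv_le_of_inv_le₀ hr' (hmax _ hr1)
  have hnorm : luxemburgNorm φ x = ((c⁻¹ : ℝ≥0) : ℝ) := hleast.csInf_eq
  rw [hnorm]
  refine ⟨by positivity, ?_⟩
  simpa using hc1

theorem luxemburgNorm_nonneg (φ : ℝ≥0 → ℝ≥0∞) (x : H →L[ℂ] H) : 0 ≤ luxemburgNorm φ x :=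
  Real.sInf_nonneg fun _ h => h.1.le

theorem luxemburgNorm_le {c : ℝ} (hc : 0 < c) (h : traceOrlicz φ ((c : ℂ)⁻¹ • x) ≤ 1) :
    luxemburgNorm φ x ≤ c :=
  csInf_le ⟨0, fun _ h => h.1.le⟩ ⟨hc, h⟩

/-- For `x ≠ 0`, write `x = N • (N⁻¹ • x)` with `N` the norm: the inner operator has trace `1`, and
convexity pulls out the factor `N ≤ 1`. -/
theorem traceOrlicz_le_luxemburgNorm (hφ : IsOrlicz φ) (hδ : DeltaTwoZero φ)
    (hx : x ∈ orliczClass H φ) (h1 : luxemburgNorm φ x ≤ 1) :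
    traceOrlicz φ x ≤ ENNReal.ofReal (luxemburgNorm φ x) := by
  rcases eq_or_ne x 0 with rfl | hx0
  · simp [traceOrlicz_zero hφ.map_zero]
  obtain ⟨hpos, hone⟩ := luxemburgNorm_pos_and_traceOrlicz_eq_one hφ hδ hx hx0
  set N := luxemburgNorm φ x
  have hle := traceOrlicz_smul_le hφ (x := (N : ℂ)⁻¹ • x) (hx.1.smul _) (r := N.toNNReal)
    (by simpa using h1)
  rw [Real.coe_toNNReal _ hpos.le, smul_inv_smul₀ (by exact_mod_cast hpos.ne'), hone, mul_one]
    at hle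
  exact hle

theorem luxemburgNorm_eq_one_iff (hφ : IsOrlicz φ) (hδ : DeltaTwoZero φ)
    (hx : x ∈ orliczClass H φ) : luxemburgNorm φ x = 1 ↔ traceOrlicz φ x = 1 := by
  constructor
  · intro h
    have hx0 : x ≠ 0 := by
      rintro rfl
      simp [luxemburgNorm_zero hφ.map_zero] at h
    have := (luxemburgNorm_pos_and_traceOrlicz_eq_one hφ hδ hx hx0).2
    rw [h] at this
    simpa using this
  · intro h
    have hle : luxemburgNorm φ x ≤ 1 := luxemburgNorm_le one_pos (by simp [h])
    have := traceOrlicz_le_luxemburgNorm hφ hδ hx hle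
    rw [h, ENNReal.one_le_ofReal] at this
    exact le_antisymm hle this

theorem tendsto_luxemburgNorm_of_traceOrlicz (hφ : IsOrlicz φ) (hδ : DeltaTwoZero φ)
    {α : Type*} {l : Filter α} {x : α → H →L[ℂ] H} (hx : ∀ n, x n ∈ orliczClass H φ)
    (h : Filter.Tendsto (fun n => traceOrlicz φ (x n)) l (𝓝 0)) :
    Filter.Tendsto (fun n => luxemburgNorm φ (x n)) l (𝓝 0) := by
  obtain ⟨u₀, hu₀, k, hk2, hk⟩ := hδ
  rw [Metric.tendsto_nhds]
  intro ε hε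
  obtain ⟨m, hm⟩ := pow_unbounded_of_one_lt ε⁻¹ one_lt_two
  have hkpos : 0 < k := zero_lt_two.trans hk2
  -- The first bound forces every `μ i` below `u₀ / 2 ^ m`, so that `δ₂` can be iterated `m` times;
  -- the second absorbs the resulting `k ^ m`. Together they give norm at most `2⁻ᵐ < ε`.
  have ev1 : ∀ᶠ n in l, traceOrlicz φ (x n) < φ (u₀ / 2 ^ m) :=
    h.eventually (gt_mem_nhds (hφ.pos _ (by positivity)))
  have ev2 : ∀ᶠ n in l, traceOrlicz φ (x n) < ((k ^ m)⁻¹ : ℝ≥0) :=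
    h.eventually (gt_mem_nhds (by exact_mod_cast (by positivity : 0 < (k ^ m)⁻¹)))
  filter_upwards [ev1, ev2] with n h1 h2
  obtain ⟨ι, b, μ, hb⟩ := exists_isSingularBasis (hx n).1
  rw [hb.traceOrlicz_eq hφ.map_zero] at h1 h2
  have hsmall : ∀ i, 2 ^ m * μ i ≤ u₀ := by
    intro i
    by_contra! hlt
    have h3 : u₀ / 2 ^ m ≤ μ i := by
      rw [div_le_iff₀ (by positivity), mul_comm]
      exact hlt.le
    exact absurd ((hφ.monotone h3).trans (ENNReal.le_tsum i)) (not_le.2 h1)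
  have hle : luxemburgNorm φ (x n) ≤ (((2 ^ m : ℝ≥0)⁻¹ : ℝ≥0) : ℝ) := by
    refine luxemburgNorm_le (by positivity) ?_
    have h4 : ((((2 ^ m : ℝ≥0)⁻¹ : ℝ≥0) : ℝ) : ℂ)⁻¹ = (((2 ^ m : ℝ≥0) : ℝ) : ℂ) := by simp
    rw [h4, hb.traceOrlicz_smul hφ.map_zero]
    calc ∑' i, φ (2 ^ m * μ i) ≤ ∑' i, (k : ℝ≥0∞) ^ m * φ (μ i) :=
          ENNReal.tsum_le_tsum fun i => map_two_pow_mul_le hk m (hsmall i)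
      _ = (k : ℝ≥0∞) ^ m * ∑' i, φ (μ i) := ENNReal.tsum_mul_left
      _ ≤ (k : ℝ≥0∞) ^ m * ((k ^ m)⁻¹ : ℝ≥0) := by gcongr
      _ = 1 := by
        rw [← ENNReal.coe_pow, ← ENNReal.coe_mul, mul_inv_cancel₀ (by positivity),
          ENNReal.coe_one]
  rw [Real.dist_eq, sub_zero, abs_of_nonneg (luxemburgNorm_nonneg _ _)]
  refine hle.trans_lt ?_
  push_cast
  exact inv_lt_of_inv_lt₀ hε hm

theorem tendsto_traceOrlicz_of_luxemburgNorm (hφ : IsOrlicz φ) (hδ : DeltaTwoZero φ)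
    {α : Type*} {l : Filter α} {x : α → H →L[ℂ] H} (hx : ∀ n, x n ∈ orliczClass H φ)
    (h : Filter.Tendsto (fun n => luxemburgNorm φ (x n)) l (𝓝 0)) :
    Filter.Tendsto (fun n => traceOrlicz φ (x n)) l (𝓝 0) := by
  have h0 : Filter.Tendsto (fun n => ENNReal.ofReal (luxemburgNorm φ (x n))) l (𝓝 0) := by
    simpa using ENNReal.tendsto_ofReal h
  refine tendsto_of_tendsto_of_tendsto_of_le_of_le' tendsto_const_nhds h0
    (Filter.Eventually.of_forall fun _ => zero_le) ?_
  filter_upwards [h.eventually (gt_mem_nhds one_pos)] with n hn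
  exact traceOrlicz_le_luxemburgNorm hφ hδ (hx n) (le_of_lt hn)

end

end OrliczOperator

theorem theorem3p1 {H : Type*} [NormedAddCommGroup H] [InnerProductSpace ℂ H] [CompleteSpace H]
    [TopologicalSpace.SeparableSpace H]
    (φ : ℝ≥0 → ℝ≥0∞) (hφ : IsOrlicz φ) (hδ : DeltaTwoZero φ) :
    (∀ x ∈ orliczClass H φ, x ≠ 0 →
      traceOrlicz φ ((luxemburgNorm φ x : ℂ)⁻¹ • x) = 1) ∧
    (∀ x ∈ orliczClass H φ, luxemburgNorm φ x = 1 ↔ traceOrlicz φ x = 1) ∧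
    (∀ x : ℕ → H →L[ℂ] H, (∀ n, x n ∈ orliczClass H φ) →
      (Filter.Tendsto (fun n => traceOrlicz φ (x n)) Filter.atTop (𝓝 0) ↔
        Filter.Tendsto (fun n => luxemburgNorm φ (x n)) Filter.atTop (𝓝 0))) ∧
    (∀ k : ℝ≥0, (∀ α : ℝ≥0, 0 < α → φ (2 * α) ≤ (k : ℝ≥0∞) * φ α) →
      ∀ x ∈ orliczClass H φ, ∀ y ∈ orliczClass H φ,
        traceOrlicz φ (x + y) ≤ (k : ℝ≥0∞) / 2 * (traceOrlicz φ x + traceOrlicz φ y)) :=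
  ⟨fun _ hx hx0 => (luxemburgNorm_pos_and_traceOrlicz_eq_one hφ hδ hx hx0).2,
    fun _ hx => luxemburgNorm_eq_one_iff hφ hδ hx,
    fun _ hx => ⟨tendsto_luxemburgNorm_of_traceOrlicz hφ hδ hx,
      tendsto_traceOrlicz_of_luxemburgNorm hφ hδ hx⟩,
    fun _ hk _ hx _ hy => traceOrlicz_add_le hφ hk hx.1 hy.1⟩
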